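/- **Setting.** A quantum circuit is a finite sequence of gates, each of which is one of the following: a Hadamard gate; a phase-shift gate $|0\rangle\langle 0|+e^{i\theta}|1\rangle\langle 1|$ with $\theta=2\pi c/2^t$ for integers $t\ge 1$ and $c$; a CNOT gate; a fan-out gate on $k+1$ qubits ($k\ge1$), $|y\rangle\bigotimes_{j=1}^k|x_j\rangle\mapsto|y\rangle\bigotimes_{j=1}^k|x_j\oplus y\rangle$; or a Toffoli gate on $k+1$ qubits ($k\ge1$), $\bigl(\bigotimes_{j=1}^k|x_j\rangle\bigr)|y\rangle\mapsto\bigl(\bigotimes_{j=1}^k|x_j\rangle\bigr)|y\oplus\bigwedge_{j=1}^kx_j\rangle$. There are no intermediate measurements. The depth of a circuit is the smallest $d$ such that its gates can be arranged into $d$ successive layers, where gates in the same layer act on pairwise disjoint sets of qubits and gates sharing a qubit keep their order. A circuit $C$ with $n$ input qubits, one output qubit, $p$ initialized and $q$ uninitialized ancillary qubits *computes* $f:\{0,1\}^n\to\{0,1\}$ if for all $x\in\{0,1\}^n$, $y\in\{0,1\}$ and every state $|\varphi\rangle$ of the $q$ uninitialized qubits, measuring the output qubit of $C\,|x\rangle|y\rangle|0^p\rangle|\varphi\rangle$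 in the computational basis yields $y\oplus f(x)$ with probability $1$. The parity function on $n$ bits maps $x$ to $1$ if $\sum_j x_j$ is odd and to $0$ otherwise. **Theorem.** Let $0\le\delta<1$ be a constant, and let $d,p,q,w:\mathbb N\to\mathbb N$ satisfy $d(n)=O((\log n)^\delta)$, $p(n)=O(\log n)$, $q(n)=n^{O(1)}$ and $w(n)=(\log n)^{O(1)}$. Then, for all sufficiently large $n$, the parity function on $n$ bits is not computed by any quantum circuit of depth at most $d(n)$ with $n$ input qubits, one output qubit, $p(n)$ initialized and $q(n)$ uninitialized ancillary qubits that consists of Hadamard gates, phase-shift gates as above, CNOT gates, fan-out gates acting on at most $w(n)$ qubits each, and Toffoli gates on arbitrarily many qubits. -/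

import Mathlib

namespace QCircuit

/-- A computational basis state of the qubits in `Q`. -/
abbrev Bits (Q : Type) : Type := Q → Bool

/-- Elementary gates on a set `Q` of qubits: Hadamard gates, phase-shift gates with angle
`2πc/2^t` (`t ≥ 1`, `c` an integer), CNOT gates, fan-out gates with one control and at least one
target, and Toffoli gates with at least one control and one target. -/
inductive Gate (Q : Type) : Type
  | hadamard (a : Q) : Gate Q
  | phase (a : Q) (c : ℤ) (t : ℕ) (ht : 1 ≤ t) : Gate Q
  | cnot (control target : Q) (h : control ≠ target) : Gate Q
  | fanout (control : Q) (targets : Finset Q) (hne : targets.Nonempty) (h : control ∉ targets) :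
      Gate Q
  | toffoli (controls : Finset Q) (target : Q) (hne : controls.Nonempty) (h : target ∉ controls) :
      Gate Q

/-- The linear map `|z⟩ ↦ |f z⟩` as a matrix in the computational basis. -/
def basisMap {Q : Type} [DecidableEq Q] [Fintype Q] (f : Bits Q → Bits Q) :
    Matrix (Bits Q) (Bits Q) ℂ :=
  Matrix.of fun z' z => if z' = f z then 1 else 0

namespace Gate

variable {Q : Type}

/-- The set of qubits on which a gate acts. -/
def support [DecidableEq Q] : Gate Q → Finset Q
  | hadamard a => {a}
  | phase a _ _ _ => {a}
  | cnot c t _ => {c, t}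
  | fanout c T _ _ => insert c T
  | toffoli S t _ _ => insert t S

/-- The matrix of a gate in the computational basis (row index: output, column index: input). -/
noncomputable def matrix [DecidableEq Q] [Fintype Q] : Gate Q → Matrix (Bits Q) (Bits Q) ℂ
  | hadamard a => Matrix.of fun z' z =>
      if ∀ r, r ≠ a → z' r = z r then
        (if z a = true ∧ z' a = true then -1 else 1) / ((Real.sqrt 2 : ℝ) : ℂ)
      else 0
  | phase a c t _ => Matrix.diagonal fun z =>
      if z a = true then Complex.exp (Complex.I * (2 * Real.pi * c / 2 ^ t)) else 1
  | cnot c t _ => basisMap fun z => Function.update z t (xor (z t) (z c))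
  | fanout c T _ _ => basisMap fun z r => if r ∈ T then xor (z r) (z c) else z r
  | toffoli S t _ _ => basisMap fun z =>
      Function.update z t (xor (z t) (decide (∀ j ∈ S, z j = true)))

/-- If the gate is a fan-out gate, then it acts on at most `w` qubits. -/
def FanoutAtMost [DecidableEq Q] (w : ℕ) : Gate Q → Prop
  | fanout c T _ _ => (insert c T).card ≤ w
  | _ => True

end Gate

/-- The qubits of a circuit with `n` input qubits, one output qubit, `p` initialized and `q`
uninitialized ancillary qubits. -/
inductive Qubit (n p q : ℕ) : Type
  | input (i : Fin n) : Qubit n p q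
  | output : Qubit n p q
  | initialized (i : Fin p) : Qubit n p q
  | uninitialized (i : Fin q) : Qubit n p q
  deriving DecidableEq, Fintype

/-- A circuit on the qubits `Q`: its gates, listed in an order in which they can be applied. -/
abbrev Circuit (Q : Type) : Type := List (Gate Q)

namespace Circuit

/-- The matrix of a circuit; the head of the list is applied first. -/
noncomputable def matrix {Q : Type} [DecidableEq Q] [Fintype Q] (C : Circuit Q) :
    Matrix (Bits Q) (Bits Q) ℂ :=
  C.foldl (fun U g => g.matrix * U) 1

/-- An arrangement of the gates of `C` into layers `0, …, d - 1`: of two gates that share a qubit,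
the one that is applied first lies in a strictly earlier layer. Equivalently, gates in the same
layer act on pairwise disjoint sets of qubits, and applying the gates layer by layer
changes only the order of gates on disjoint sets of qubits. -/
def IsLayering {Q : Type} [DecidableEq Q] (C : Circuit Q) (d : ℕ)
    (layer : Fin C.length → Fin d) : Prop :=
  ∀ i j, i < j → ¬ Disjoint (C.get i).support (C.get j).support → layer i < layer j

/-- The depth: the smallest possible number of layers. -/
noncomputable def depth {Q : Type} [DecidableEq Q] (C : Circuit Q) : ℕ :=
  sInf {d | ∃ layer : Fin C.length → Fin d, IsLayering C d layer}

variable {n p q : ℕ}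

/-- The initial state `|x⟩|y⟩|0^p⟩|φ⟩`, where `φ` is the state of the uninitialized qubits. -/
def initialState (p : ℕ) (x : Fin n → Bool) (y : Bool) (φ : EuclideanSpace ℂ (Fin q → Bool)) :
    Bits (Qubit n p q) → ℂ := fun z =>
  if (∀ i, z (.input i) = x i) ∧ z .output = y ∧ (∀ i, z (.initialized i) = false) then
    φ (fun i => z (.uninitialized i))
  else 0

/-- The probability that measuring the output qubit in the computational basis at the end of the
computation yields `b`. -/
noncomputable def outputProb (C : Circuit (Qubit n p q)) (x : Fin n → Bool) (y : Bool)
    (φ : EuclideanSpace ℂ (Fin q → Bool)) (b : Bool) : ℝ :=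
  ∑ z : Bits (Qubit n p q),
    if z .output = b then ‖(C.matrix.mulVec (initialState p x y φ)) z‖ ^ 2 else 0

/-- `C` computes `f`: on input `x`, with the output qubit initialized to `y`, the output is
`y ⊕ f x` with probability 1, for every (unit vector) state `φ` of the uninitialized qubits. By
convexity it is the same to ask this for every mixed state. -/
def Computes (C : Circuit (Qubit n p q)) (f : (Fin n → Bool) → Bool) : Prop :=
  ∀ (x : Fin n → Bool) (y : Bool) (φ : EuclideanSpace ℂ (Fin q → Bool)), ‖φ‖ = 1 →
    outputProb C x y φ (xor y (f x)) = 1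

end Circuit

/-- The parity function on `n` bits. -/
def parity (n : ℕ) (x : Fin n → Bool) : Bool :=
  decide (Odd (Finset.univ.filter fun i => x i = true).card)

end QCircuit

/-!
On a register of `N` qubits, a Toffoli gate with `K` controls moves only a fraction `2 ^ (-K)` of
the basis states, so deleting the Toffoli gates with many controls changes the matrix of the
circuit little in Frobenius norm. In the truncated circuit every gate acts on few qubits, say at
most `W`, so in depth `d` the output qubit depends on at most `W ^ d < n` qubits and misses some
input. Flipping that input flips the parity but not the output distribution of the truncated
circuit. Hence on each of the `2 ^ (N - p)` basis states with zeroed initialized ancillas, or on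
its flip, the two circuits differ by a constant, which makes their squared distance at least of
the order of `2 ^ (N - p)`. For `K` somewhat larger than `p` this contradicts the first bound.
-/

namespace QCircuit

open scoped Matrix

section BasisMap

variable {Q : Type} [DecidableEq Q] [Fintype Q]

lemma basisMap_mul_basisMap (f g : Bits Q → Bits Q) :
    basisMap f * basisMap g = basisMap (f ∘ g) := by
  ext z' z
  simp [basisMap, Matrix.mul_apply]

lemma basisMap_id : basisMap (id : Bits Q → Bits Q) = 1 := by
  ext z' z
  simp [basisMap, Matrix.one_apply]

lemma basisMap_mul_self {f : Bits Q → Bits Q} (hf : Function.Involutive f) :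
    basisMap f * basisMap f = 1 := by
  rw [basisMap_mul_basisMap, hf.comp_self, basisMap_id]

lemma conjTranspose_basisMap {f : Bits Q → Bits Q} (hf : Function.Involutive f) :
    (basisMap f)ᴴ = basisMap f := by
  ext z' z
  simp only [Matrix.conjTranspose_apply, basisMap, Matrix.of_apply, hf.eq_iff.symm.trans eq_comm,
    apply_ite star, star_one, star_zero]

lemma basisMap_mem_unitaryGroup {f : Bits Q → Bits Q} (hf : Function.Involutive f) :
    basisMap f ∈ Matrix.unitaryGroup (Bits Q) ℂ := by
  rw [Matrix.mem_unitaryGroup_iff, Matrix.star_eq_conjTranspose, conjTranspose_basisMap hf,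
    basisMap_mul_self hf]

lemma basisMap_mul_diagonal {f : Bits Q → Bits Q} {u v : Bits Q → ℂ} (h : ∀ z, v (f z) = u z) :
    basisMap f * Matrix.diagonal u = Matrix.diagonal v * basisMap f := by
  ext z' z
  simp only [Matrix.mul_diagonal, Matrix.diagonal_mul, basisMap, Matrix.of_apply]
  split_ifs with hz
  · rw [hz, h, mul_comm]
  · simp

end BasisMap

section LocalOperators

variable {Q : Type} [DecidableEq Q]

/-- The negation of all bits in `S`, that is, the action of the Pauli operator `X` on the qubits in
`S` on basis states. -/
def flipBits (S : Finset Q) (z : Bits Q) : Bits Q := fun r => if r ∈ S then !z r else z r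

lemma flipBits_involutive (S : Finset Q) : Function.Involutive (flipBits S) := fun z => by
  ext r
  by_cases hr : r ∈ S <;> simp [flipBits, hr]

lemma flipBits_apply_of_notMem {S : Finset Q} {r : Q} (hr : r ∉ S) (z : Bits Q) :
    flipBits S z r = z r := if_neg hr

lemma flipBits_comp_comm (S T : Finset Q) : flipBits S ∘ flipBits T = flipBits T ∘ flipBits S := by
  ext z r
  by_cases hS : r ∈ S <;> by_cases hT : r ∈ T <;> simp [flipBits, hS, hT]

lemma flipBits_insert {S : Finset Q} {r : Q} (hr : r ∉ S) :
    flipBits (insert r S) = flipBits {r} ∘ flipBits S := by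
  ext z s
  by_cases hs : s = r
  · simp [flipBits, hs, hr]
  · simp [flipBits, hs]

/-- The permutation of the basis states that negates the targets `T` when all controls in `S` are
`1`. It describes CNOT, fan-out and Toffoli gates alike. -/
def controlledFlip (S T : Finset Q) (z : Bits Q) : Bits Q :=
  if ∀ r ∈ S, z r = true then flipBits T z else z

lemma controlledFlip_involutive {S T : Finset Q} (h : Disjoint S T) :
    Function.Involutive (controlledFlip S T) := fun z => by
  have hS : (∀ r ∈ S, flipBits T z r = true) ↔ ∀ r ∈ S, z r = true :=
    forall₂_congr fun r hr => by
      rw [flipBits_apply_of_notMem (Finset.disjoint_left.1 h hr)]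
  by_cases hz : ∀ r ∈ S, z r = true
  · simp only [controlledFlip, if_pos hz, if_pos (hS.2 hz), flipBits_involutive T z]
  · simp only [controlledFlip, if_neg hz]

variable [Fintype Q]

/-- The projection onto the span of the basis states in which all qubits in `S` have the value
`b`. -/
def proj (S : Finset Q) (b : Bool) : Matrix (Bits Q) (Bits Q) ℂ :=
  Matrix.diagonal fun z => if ∀ r ∈ S, z r = b then 1 else 0

lemma conjTranspose_proj (S : Finset Q) (b : Bool) : (proj S b)ᴴ = proj S b := by
  rw [proj, Matrix.diagonal_conjTranspose]
  congr 1
  ext z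
  simp only [Pi.star_apply, apply_ite star, star_one, star_zero]

lemma proj_mul_self (S : Finset Q) (b : Bool) : proj S b * proj S b = proj S b := by
  simp only [proj, Matrix.diagonal_mul_diagonal, mul_ite, mul_one, mul_zero, ← ite_and, and_self]

lemma proj_insert (S : Finset Q) (r : Q) (b : Bool) :
    proj (insert r S) b = proj {r} b * proj S b := by
  simp only [proj, Matrix.diagonal_mul_diagonal, Finset.forall_mem_insert, Finset.mem_singleton,
    forall_eq, ite_and, ite_mul, one_mul, zero_mul]

lemma basisMap_controlledFlip (S T : Finset Q) :
    basisMap (controlledFlip S T) =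
      basisMap (flipBits T) * proj S true + (1 - proj S true) := by
  ext z' z
  simp only [basisMap, proj, Matrix.add_apply, Matrix.sub_apply, Matrix.mul_diagonal,
    Matrix.of_apply, Matrix.one_apply, Matrix.diagonal_apply]
  by_cases hz : ∀ r ∈ S, z r = true
  · rcases eq_or_ne z' z with rfl | hne
    · simp only [controlledFlip, if_pos hz, if_true, mul_one, sub_self, add_zero]
    · simp only [controlledFlip, if_pos hz, if_neg hne, mul_one, sub_self, add_zero]
  · rcases eq_or_ne z' z with rfl | hne
    · simp only [controlledFlip, if_neg hz, if_true, mul_zero, sub_zero, zero_add]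
    · simp only [controlledFlip, if_neg hz, if_neg hne, mul_zero, sub_zero, zero_add]

/-- The algebra of operators that act only on the qubits in `S`, generated by the Pauli operators
`X` and the projections onto `|0⟩` and `|1⟩` of single qubits in `S`. -/
noncomputable def localAlgebra (S : Finset Q) : Subalgebra ℂ (Matrix (Bits Q) (Bits Q) ℂ) :=
  Algebra.adjoin ℂ {A | ∃ r ∈ S, A = basisMap (flipBits {r}) ∨ ∃ b, A = proj {r} b}

lemma localAlgebra_mono {S T : Finset Q} (h : S ⊆ T) : localAlgebra S ≤ localAlgebra T :=
  Algebra.adjoin_mono fun _ ⟨r, hr, hA⟩ => ⟨r, h hr, hA⟩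

lemma conjTranspose_mem_localAlgebra {S : Finset Q} {A : Matrix (Bits Q) (Bits Q) ℂ}
    (hA : A ∈ localAlgebra S) : Aᴴ ∈ localAlgebra S := by
  induction hA using Algebra.adjoin_induction with
  | mem A hA =>
    have hsa : Aᴴ = A := by
      obtain ⟨r, -, rfl | ⟨b, rfl⟩⟩ := hA
      · exact conjTranspose_basisMap (flipBits_involutive _)
      · exact conjTranspose_proj _ b
    rw [hsa]
    exact Algebra.subset_adjoin hA
  | algebraMap c =>
    rw [Algebra.algebraMap_eq_smul_one, Matrix.conjTranspose_smul, Matrix.conjTranspose_one]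
    exact Subalgebra.smul_mem _ (one_mem _) _
  | add A B _ _ hA hB =>
    rw [Matrix.conjTranspose_add]
    exact add_mem hA hB
  | mul A B _ _ hA hB =>
    rw [Matrix.conjTranspose_mul]
    exact mul_mem hB hA

lemma commute_of_mem_localAlgebra {S T : Finset Q} (h : Disjoint S T)
    {A B : Matrix (Bits Q) (Bits Q) ℂ} (hA : A ∈ localAlgebra S) (hB : B ∈ localAlgebra T) :
    Commute A B := by
  have flip_proj {r s : Q} (hrs : r ≠ s) (b : Bool) :
      Commute (basisMap (flipBits {r})) (proj {s} b) :=
    basisMap_mul_diagonal fun z => by simp [flipBits, hrs.symm]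
  refine Algebra.commute_of_mem_adjoin_of_forall_mem_commute hB fun B hB => ?_
  refine (Algebra.commute_of_mem_adjoin_of_forall_mem_commute hA fun A hA => ?_).symm
  obtain ⟨r, hr, hA⟩ := hA
  obtain ⟨s, hs, hB⟩ := hB
  have hrs : r ≠ s := fun hrs => Finset.disjoint_left.1 h hr (hrs ▸ hs)
  rcases hA with rfl | ⟨b, rfl⟩ <;> rcases hB with rfl | ⟨c, rfl⟩
  · rw [Commute, SemiconjBy, basisMap_mul_basisMap, basisMap_mul_basisMap, flipBits_comp_comm]
  · exact (flip_proj hrs c).symm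
  · exact flip_proj hrs.symm b
  · exact Matrix.commute_diagonal _ _

lemma basisMap_flipBits_mem_localAlgebra (S : Finset Q) :
    basisMap (flipBits S) ∈ localAlgebra S := by
  induction S using Finset.induction_on with
  | empty => exact (basisMap_id (Q := Q)) ▸ one_mem (localAlgebra ∅)
  | insert r S hr ih =>
    rw [flipBits_insert hr, ← basisMap_mul_basisMap]
    exact mul_mem (Algebra.subset_adjoin ⟨r, Finset.mem_insert_self r S, .inl rfl⟩)
      (localAlgebra_mono (Finset.subset_insert r S) ih)

lemma proj_mem_localAlgebra (S : Finset Q) (b : Bool) : proj S b ∈ localAlgebra S := by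
  induction S using Finset.induction_on with
  | empty => simp [proj, one_mem]
  | insert r S _ ih =>
    rw [proj_insert]
    exact mul_mem (Algebra.subset_adjoin ⟨r, Finset.mem_insert_self r S, .inr ⟨b, rfl⟩⟩)
      (localAlgebra_mono (Finset.subset_insert r S) ih)

lemma basisMap_controlledFlip_mem_localAlgebra (S T : Finset Q) :
    basisMap (controlledFlip S T) ∈ localAlgebra (S ∪ T) := by
  have hS : proj S true ∈ localAlgebra (S ∪ T) :=
    localAlgebra_mono Finset.subset_union_left (proj_mem_localAlgebra S true)
  have hT : basisMap (flipBits T) ∈ localAlgebra (S ∪ T) :=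
    localAlgebra_mono Finset.subset_union_right (basisMap_flipBits_mem_localAlgebra T)
  rw [basisMap_controlledFlip]
  exact add_mem (mul_mem hT hS) (sub_mem (one_mem _) hS)

end LocalOperators

section Gates

variable {Q : Type} [DecidableEq Q] [Fintype Q]

namespace Gate

lemma matrix_hadamard (a : Q) :
    (hadamard a).matrix =
      ((√2 : ℝ) : ℂ)⁻¹ • (basisMap (flipBits {a}) + (proj {a} false - proj {a} true)) := by
  ext z' z
  simp only [matrix, Matrix.of_apply, Matrix.smul_apply, Matrix.add_apply, Matrix.sub_apply,
    basisMap, proj, Finset.mem_singleton, forall_eq, smul_eq_mul]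
  by_cases hne : ∀ r, r ≠ a → z' r = z r
  · rcases eq_or_ne (z' a) (z a) with ha | ha
    · obtain rfl : z' = z := funext fun r => by
        by_cases hr : r = a
        · rw [hr, ha]
        · exact hne r hr
      have hflip : z' ≠ flipBits {a} z' := fun h => by simpa [flipBits] using congrFun h a
      cases hz : z' a <;> simp [hz, hflip, div_eq_inv_mul]
    · obtain rfl : z' = flipBits {a} z := funext fun r => by
        by_cases hr : r = a
        · simpa [hr, flipBits, Bool.eq_not] using ha
        · simpa [flipBits, hr] using hne r hr
      have hz : flipBits {a} z ≠ z := fun h => ha (congrFun h a)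
      cases hza : z a <;> simp [hza, hz, flipBits]
  · have hz : z' ≠ z := fun h => hne fun r _ => by rw [h]
    have hflip : z' ≠ flipBits {a} z := fun h => hne fun r hr => by simp [h, flipBits, hr]
    simp [hne, hz, hflip]

lemma matrix_phase (a : Q) (c : ℤ) (t : ℕ) (ht : 1 ≤ t) :
    (phase a c t ht).matrix = proj {a} false +
      Complex.exp (Complex.I * (2 * Real.pi * c / 2 ^ t)) • proj {a} true := by
  rw [matrix, proj, proj, ← Matrix.diagonal_smul, Matrix.diagonal_add]
  congr 1
  ext z
  cases hz : z a <;> simp [hz]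

lemma matrix_cnot (c t : Q) (h : c ≠ t) :
    (cnot c t h).matrix = basisMap (controlledFlip {c} {t}) := by
  rw [matrix]
  congr 1
  ext z r
  by_cases hr : r = t <;> cases hz : z c <;> simp [controlledFlip, flipBits, hr, hz]

lemma matrix_fanout (c : Q) (T : Finset Q) (hne : T.Nonempty) (h : c ∉ T) :
    (fanout c T hne h).matrix = basisMap (controlledFlip {c} T) := by
  rw [matrix]
  congr 1
  ext z r
  cases hz : z c <;> simp [controlledFlip, flipBits, hz]

lemma matrix_toffoli (S : Finset Q) (t : Q) (hne : S.Nonempty) (h : t ∉ S) :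
    (toffoli S t hne h).matrix = basisMap (controlledFlip S {t}) := by
  rw [matrix]
  congr 1
  ext z r
  by_cases hz : ∀ r ∈ S, z r = true
  · simp only [controlledFlip, if_pos hz, decide_eq_true hz, flipBits, Bool.xor_true]
    by_cases hr : r = t <;> simp [hr]
  · simp only [controlledFlip, if_neg hz, decide_eq_false hz, Bool.xor_false,
      Function.update_eq_self]

lemma matrix_mem_localAlgebra (g : Gate Q) : g.matrix ∈ localAlgebra g.support := by
  cases g with
  | hadamard a =>
    rw [matrix_hadamard]
    exact Subalgebra.smul_mem _ (add_mem (basisMap_flipBits_mem_localAlgebra {a})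
      (sub_mem (proj_mem_localAlgebra {a} false) (proj_mem_localAlgebra {a} true))) _
  | phase a c t ht =>
    rw [matrix_phase]
    exact add_mem (proj_mem_localAlgebra {a} false)
      (Subalgebra.smul_mem _ (proj_mem_localAlgebra {a} true) _)
  | cnot c t h =>
    rw [matrix_cnot]
    exact basisMap_controlledFlip_mem_localAlgebra {c} {t}
  | fanout c T hne h =>
    rw [matrix_fanout]
    exact basisMap_controlledFlip_mem_localAlgebra {c} T
  | toffoli S t hne h =>
    rw [matrix_toffoli, support, Finset.insert_eq, Finset.union_comm]
    exact basisMap_controlledFlip_mem_localAlgebra S {t}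

lemma matrix_hadamard_mem_unitaryGroup (a : Q) :
    (hadamard a).matrix ∈ Matrix.unitaryGroup (Bits Q) ℂ := by
  set X : Matrix (Bits Q) (Bits Q) ℂ := basisMap (flipBits {a}) with hX
  set Z : Matrix (Bits Q) (Bits Q) ℂ := proj {a} false - proj {a} true with hZ
  have hZ_diag : Z = Matrix.diagonal fun z => if z a = true then -1 else 1 := by
    rw [hZ, proj, proj, Matrix.diagonal_sub]
    congr 1
    ext z
    cases hz : z a <;> simp [hz]
  have hXX : X * X = 1 := basisMap_mul_self (flipBits_involutive {a})
  have hZZ : Z * Z = 1 := by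
    rw [hZ_diag, Matrix.diagonal_mul_diagonal, ← Matrix.diagonal_one]
    congr 1
    ext z
    split_ifs <;> simp
  have hXZ : X * Z = -(Z * X) := by
    rw [hZ_diag, ← neg_mul, Matrix.diagonal_neg]
    refine basisMap_mul_diagonal fun z => ?_
    cases hz : z a <;> simp [flipBits, hz]
  have hself : (X + Z)ᴴ = X + Z := by
    rw [Matrix.conjTranspose_add, hX, conjTranspose_basisMap (flipBits_involutive {a}), hZ,
      Matrix.conjTranspose_sub, conjTranspose_proj, conjTranspose_proj]
  have hsq : (X + Z) * (X + Z) = (2 : ℂ) • 1 := by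
    rw [add_mul, mul_add, mul_add, hXX, hZZ, hXZ, two_smul]
    abel
  have hsqrt : ((√2 : ℝ) : ℂ)⁻¹ * ((√2 : ℝ) : ℂ)⁻¹ * 2 = 1 := by
    rw [← mul_inv, ← Complex.ofReal_mul, Real.mul_self_sqrt (by norm_num)]
    norm_num
  rw [matrix_hadamard, Matrix.mem_unitaryGroup_iff, Matrix.star_eq_conjTranspose,
    Matrix.conjTranspose_smul, hself, smul_mul_smul_comm, hsq, smul_smul, RCLike.star_def,
    map_inv₀, Complex.conj_ofReal, hsqrt, one_smul]

lemma matrix_phase_mem_unitaryGroup (a : Q) (c : ℤ) (t : ℕ) (ht : 1 ≤ t) :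
    (phase a c t ht).matrix ∈ Matrix.unitaryGroup (Bits Q) ℂ := by
  have hnorm : ‖Complex.exp (Complex.I * (2 * Real.pi * c / 2 ^ t))‖ = 1 := by
    rw [mul_comm]
    exact_mod_cast Complex.norm_exp_ofReal_mul_I (2 * Real.pi * c / 2 ^ t)
  rw [Matrix.mem_unitaryGroup_iff, Matrix.star_eq_conjTranspose, matrix,
    Matrix.diagonal_conjTranspose, Matrix.diagonal_mul_diagonal, ← Matrix.diagonal_one]
  congr 1
  ext z
  rw [Pi.star_apply, RCLike.star_def, Complex.mul_conj, Complex.normSq_eq_norm_sq]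
  split_ifs
  · simp [hnorm]
  · simp

lemma matrix_mem_unitaryGroup (g : Gate Q) : g.matrix ∈ Matrix.unitaryGroup (Bits Q) ℂ := by
  cases g with
  | hadamard a => exact matrix_hadamard_mem_unitaryGroup a
  | phase a c t ht => exact matrix_phase_mem_unitaryGroup a c t ht
  | cnot c t h =>
    rw [matrix_cnot]
    exact basisMap_mem_unitaryGroup
      (controlledFlip_involutive (Finset.disjoint_singleton.2 h))
  | fanout c T hne h =>
    rw [matrix_fanout]
    exact basisMap_mem_unitaryGroup
      (controlledFlip_involutive (Finset.disjoint_singleton_left.2 h))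
  | toffoli S t hne h =>
    rw [matrix_toffoli]
    exact basisMap_mem_unitaryGroup
      (controlledFlip_involutive (Finset.disjoint_singleton_right.2 h))

end Gate

namespace Circuit

lemma matrix_append_singleton (C : Circuit Q) (g : Gate Q) :
    matrix (C ++ [g]) = g.matrix * C.matrix := by
  simp [matrix]

lemma matrix_mem_unitaryGroup (C : Circuit Q) :
    C.matrix ∈ Matrix.unitaryGroup (Bits Q) ℂ := by
  induction C using List.reverseRecOn with
  | nil => simp [matrix, one_mem]
  | append_singleton C g ih =>
    rw [matrix_append_singleton]
    exact mul_mem g.matrix_mem_unitaryGroup ih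

end Circuit

end Gates

section Norms

open scoped Matrix.Norms.Frobenius

section ColNorm

variable {ι : Type*} [Fintype ι]

/-- The norm of the column `A|z⟩` of the matrix `A`. -/
noncomputable def colNorm (A : Matrix ι ι ℂ) (z : ι) : ℝ := ‖WithLp.toLp 2 (A.col z)‖

lemma colNorm_nonneg (A : Matrix ι ι ℂ) (z : ι) : 0 ≤ colNorm A z := norm_nonneg _

lemma colNorm_sq (A : Matrix ι ι ℂ) (z : ι) : colNorm A z ^ 2 = ∑ z', ‖A z' z‖ ^ 2 :=
  EuclideanSpace.norm_sq_eq _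

lemma ofReal_colNorm_sq (A : Matrix ι ι ℂ) (z : ι) :
    ((colNorm A z ^ 2 : ℝ) : ℂ) = (Aᴴ * A) z z := by
  simp only [colNorm_sq, Matrix.mul_apply, Matrix.conjTranspose_apply, Complex.ofReal_sum,
    RCLike.star_def, Complex.ofReal_pow, Complex.conj_mul']

lemma abs_colNorm_sub_colNorm_le (A B : Matrix ι ι ℂ) (z : ι) :
    |colNorm A z - colNorm B z| ≤ colNorm (A - B) z :=
  abs_norm_sub_norm_le _ _

lemma frobenius_norm_sq_eq_sum_colNorm_sq (A : Matrix ι ι ℂ) :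
    ‖A‖ ^ 2 = ∑ z, colNorm A z ^ 2 := by
  simp only [colNorm_sq]
  rw [Matrix.frobenius_norm_def, ← Real.rpow_natCast, ← Real.rpow_mul (by positivity),
    Finset.sum_comm]
  norm_num

variable [DecidableEq ι]

lemma colNorm_unitary_mul {U : Matrix ι ι ℂ} (hU : U ∈ Matrix.unitaryGroup ι ℂ)
    (A : Matrix ι ι ℂ) (z : ι) : colNorm (U * A) z = colNorm A z := by
  rw [Matrix.mem_unitaryGroup_iff', Matrix.star_eq_conjTranspose] at hU
  refine (sq_eq_sq₀ (colNorm_nonneg _ _) (colNorm_nonneg _ _)).1 (Complex.ofReal_injective ?_)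
  rw [ofReal_colNorm_sq, ofReal_colNorm_sq, Matrix.conjTranspose_mul, Matrix.mul_assoc,
    ← Matrix.mul_assoc _ U, hU, Matrix.one_mul]

lemma colNorm_eq_one {U : Matrix ι ι ℂ} (hU : U ∈ Matrix.unitaryGroup ι ℂ) (z : ι) :
    colNorm U z = 1 := by
  rw [Matrix.mem_unitaryGroup_iff', Matrix.star_eq_conjTranspose] at hU
  refine (pow_eq_one_iff_of_nonneg (colNorm_nonneg U z) two_ne_zero).1 (Complex.ofReal_injective ?_)
  rw [ofReal_colNorm_sq, hU, Matrix.one_apply_eq, Complex.ofReal_one]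

lemma frobenius_norm_unitary_mul {U : Matrix ι ι ℂ} (hU : U ∈ Matrix.unitaryGroup ι ℂ)
    (A : Matrix ι ι ℂ) : ‖U * A‖ = ‖A‖ := by
  refine (sq_eq_sq₀ (norm_nonneg _) (norm_nonneg _)).1 ?_
  simp only [frobenius_norm_sq_eq_sum_colNorm_sq, colNorm_unitary_mul hU]

lemma frobenius_norm_mul_unitary {U : Matrix ι ι ℂ} (hU : U ∈ Matrix.unitaryGroup ι ℂ)
    (A : Matrix ι ι ℂ) : ‖A * U‖ = ‖A‖ := by
  rw [← Matrix.frobenius_norm_conjTranspose, Matrix.conjTranspose_mul,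
    ← Matrix.star_eq_conjTranspose U, frobenius_norm_unitary_mul (Unitary.star_mem hU),
    Matrix.frobenius_norm_conjTranspose]

end ColNorm

variable {Q : Type} [DecidableEq Q] [Fintype Q]

lemma colNorm_proj_mul_sq (o : Q) (b : Bool) (A : Matrix (Bits Q) (Bits Q) ℂ) (z : Bits Q) :
    colNorm (proj {o} b * A) z ^ 2 = ∑ z', if z' o = b then ‖A z' z‖ ^ 2 else 0 := by
  rw [colNorm_sq]
  refine Finset.sum_congr rfl fun z' _ => ?_
  by_cases hz' : z' o = b <;> simp [proj, hz']

lemma colNorm_proj_mul_le (o : Q) (b : Bool) (A : Matrix (Bits Q) (Bits Q) ℂ) (z : Bits Q) :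
    colNorm (proj {o} b * A) z ≤ colNorm A z := by
  refine (sq_le_sq₀ (colNorm_nonneg _ _) (colNorm_nonneg _ _)).1 ?_
  rw [colNorm_proj_mul_sq, colNorm_sq]
  exact Finset.sum_le_sum fun z' _ => by split_ifs <;> simp

lemma sq_colNorm_proj_mul_sub_le (o : Q) (b : Bool) (A B : Matrix (Bits Q) (Bits Q) ℂ)
    (z : Bits Q) :
    (colNorm (proj {o} b * A) z - colNorm (proj {o} b * B) z) ^ 2 ≤ colNorm (A - B) z ^ 2 := by
  refine sq_le_sq' (neg_le_of_abs_le ?_) (le_of_abs_le ?_) <;>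
  · refine (abs_colNorm_sub_colNorm_le _ _ z).trans ?_
    rw [← Matrix.mul_sub]
    exact colNorm_proj_mul_le o b _ z

lemma colNorm_proj_mul_sq_add (o : Q) (b : Bool) (A : Matrix (Bits Q) (Bits Q) ℂ) (z : Bits Q) :
    colNorm (proj {o} b * A) z ^ 2 + colNorm (proj {o} (!b) * A) z ^ 2 = colNorm A z ^ 2 := by
  rw [colNorm_proj_mul_sq, colNorm_proj_mul_sq, colNorm_sq, ← Finset.sum_add_distrib]
  refine Finset.sum_congr rfl fun z' _ => ?_
  by_cases hz' : z' o = b <;> simp [hz']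

lemma card_filter_forall_mem_eq_mul_two_pow (S : Finset Q) (b : Bool) :
    (Finset.univ.filter fun z : Bits Q => ∀ r ∈ S, z r = b).card * 2 ^ S.card =
      2 ^ Fintype.card Q := by
  have hpi : (Finset.univ.filter fun z : Bits Q => ∀ r ∈ S, z r = b) =
      Fintype.piFinset fun r => if r ∈ S then {b} else Finset.univ := by
    ext z
    simp only [Finset.mem_filter, Finset.mem_univ, true_and, Fintype.mem_piFinset]
    exact forall_congr' fun r => by by_cases hr : r ∈ S <;> simp [hr]
  have hpow : (2 : ℕ) ^ S.card = ∏ r : Q, if r ∈ S then 2 else 1 := by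
    simp [Finset.prod_ite_mem]
  rw [hpi, Fintype.card_piFinset, hpow, ← Finset.prod_mul_distrib, ← Finset.card_univ,
    ← Finset.prod_const]
  exact Finset.prod_congr rfl fun r _ => by by_cases hr : r ∈ S <;> simp [hr]

lemma frobenius_norm_basisMap_sub_one_sq (f : Bits Q → Bits Q) :
    ‖basisMap f - 1‖ ^ 2 = 2 * (Finset.univ.filter fun z => f z ≠ z).card := by
  have hcol (z : Bits Q) : colNorm (basisMap f - 1) z ^ 2 = if f z ≠ z then 2 else 0 := by
    rw [colNorm_sq]
    split_ifs with hz
    · have hentry (z' : Bits Q) : ‖(basisMap f - 1) z' z‖ ^ 2 =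
          (if z' = f z then 1 else 0) + (if z' = z then 1 else 0) := by
        simp only [Matrix.sub_apply, basisMap, Matrix.of_apply, Matrix.one_apply]
        split_ifs with hf hid
        · exact absurd (hf.symm.trans hid) hz
        all_goals simp
      simp only [hentry, Finset.sum_add_distrib, Finset.sum_ite_eq', Finset.mem_univ, if_true]
      norm_num
    · simp [basisMap, Matrix.one_apply, not_not.1 hz]
  rw [frobenius_norm_sq_eq_sum_colNorm_sq, Finset.sum_congr rfl fun z _ => hcol z,
    ← Finset.sum_filter, Finset.sum_const, nsmul_eq_mul, mul_comm]

lemma frobenius_norm_basisMap_controlledFlip_sub_one_sq_le (S T : Finset Q) :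
    ‖basisMap (controlledFlip S T) - 1‖ ^ 2 ≤ 2 * (2 ^ Fintype.card Q / 2 ^ S.card) := by
  have hsub : (Finset.univ.filter fun z => controlledFlip S T z ≠ z) ⊆
      Finset.univ.filter fun z => ∀ r ∈ S, z r = true :=
    Finset.monotone_filter_right _ fun z _ hz => by_contra fun h => hz (if_neg h)
  have hcard : ((Finset.univ.filter fun z : Bits Q => ∀ r ∈ S, z r = true).card : ℝ) =
      2 ^ Fintype.card Q / 2 ^ S.card :=
    eq_div_of_mul_eq (by positivity)
      (by exact_mod_cast card_filter_forall_mem_eq_mul_two_pow S true)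
  rw [frobenius_norm_basisMap_sub_one_sq, ← hcard]
  gcongr

lemma Circuit.frobenius_norm_sub_filter_le (C : Circuit Q) (keep : Gate Q → Bool) {ε : ℝ}
    (hε : 0 ≤ ε) (h : ∀ g ∈ C, keep g = false → ‖g.matrix - 1‖ ≤ ε) :
    ‖C.matrix - Circuit.matrix (C.filter keep)‖ ≤ C.length * ε := by
  induction C using List.reverseRecOn with
  | nil => simp [Circuit.matrix]
  | append_singleton C g ih =>
    have ih := ih fun g hg => h g (List.mem_append_left _ hg)
    set C' := C.filter keep
    rw [List.filter_append, List.length_append, matrix_append_singleton, List.length_singleton,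
      Nat.cast_add_one, add_one_mul]
    cases hg : keep g with
    | true =>
      rw [List.filter_singleton, hg, cond_true, matrix_append_singleton, ← Matrix.mul_sub,
        frobenius_norm_unitary_mul g.matrix_mem_unitaryGroup]
      exact ih.trans (le_add_of_nonneg_right hε)
    | false =>
      rw [List.filter_singleton, hg, cond_false, List.append_nil]
      calc ‖g.matrix * matrix C - matrix C'‖
          = ‖g.matrix * (matrix C - matrix C') + (g.matrix - 1) * matrix C'‖ := by
            rw [mul_sub, sub_mul, one_mul, sub_add_sub_cancel]
        _ ≤ ‖g.matrix * (matrix C - matrix C')‖ + ‖(g.matrix - 1) * matrix C'‖ := norm_add_le _ _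
        _ = ‖matrix C - matrix C'‖ + ‖g.matrix - 1‖ := by
            rw [frobenius_norm_unitary_mul g.matrix_mem_unitaryGroup,
              frobenius_norm_mul_unitary (matrix_mem_unitaryGroup C')]
        _ ≤ C.length * ε + ε := add_le_add ih (h g (by simp) hg)

end Norms

section LightCone

variable {Q : Type} [DecidableEq Q]

lemma Gate.support_nonempty (g : Gate Q) : g.support.Nonempty := by
  cases g <;> simp [Gate.support]

namespace Circuit

lemma exists_isLayering {C : Circuit Q} {d : ℕ} (h : C.depth ≤ d) :
    ∃ layer : Fin C.length → Fin d, IsLayering C d layer := by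
  obtain ⟨layer, hlayer⟩ := Nat.sInf_mem (s := {d | ∃ layer, IsLayering C d layer})
    ⟨C.length, id, fun _ _ hij _ => hij⟩
  exact ⟨fun i => Fin.castLE h (layer i), hlayer⟩

lemma depth_le_of_isLayering {C : Circuit Q} {d : ℕ} {layer : Fin C.length → Fin d}
    (h : IsLayering C d layer) : C.depth ≤ d :=
  Nat.sInf_le ⟨layer, h⟩

lemma depth_le_of_sublist {C C' : Circuit Q} (h : C'.Sublist C) : depth C' ≤ depth C := by
  obtain ⟨layer, hlayer⟩ := exists_isLayering (C := C) le_rfl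
  obtain ⟨e, he⟩ := List.sublist_iff_exists_fin_orderEmbedding_get_eq.1 h
  refine depth_le_of_isLayering (layer := layer ∘ e) fun i j hij hd => ?_
  rw [he, he] at hd
  exact hlayer (e i) (e j) (e.strictMono hij) hd

lemma length_le_mul_card [Fintype Q] {C : Circuit Q} {d : ℕ} (h : C.depth ≤ d) :
    C.length ≤ d * Fintype.card Q := by
  obtain ⟨layer, hlayer⟩ := exists_isLayering h
  choose r hr using fun i => (C.get i).support_nonempty
  have hne {i j : Fin C.length} (hij : i < j) : (layer i, r i) ≠ (layer j, r j) := fun heq => by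
    obtain ⟨hl, hr'⟩ := Prod.mk.inj heq
    exact (hlayer i j hij (Finset.not_disjoint_iff.2 ⟨r i, hr i, hr' ▸ hr j⟩)).ne hl
  have hinj : Function.Injective fun i => (layer i, r i) := fun i j heq =>
    le_antisymm (not_lt.1 fun hji => hne hji heq.symm) (not_lt.1 fun hij => hne hij heq)
  simpa using Fintype.card_le_of_injective _ hinj

/-- The backward light cone of the qubits in `S`: all qubits from which the values of the qubits
in `S` at the end of the circuit can be influenced. -/
def lightCone (C : Circuit Q) (S : Finset Q) : Finset Q :=
  C.foldr (fun g T => if Disjoint T g.support then T else T ∪ g.support) S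

lemma lightCone_append_singleton (C : Circuit Q) (g : Gate Q) (S : Finset Q) :
    lightCone (C ++ [g]) S =
      lightCone C (if Disjoint S g.support then S else S ∪ g.support) := by
  rw [lightCone, List.foldr_append]
  rfl

lemma conj_mem_localAlgebra_lightCone [Fintype Q] (C : Circuit Q) {S : Finset Q}
    {A : Matrix (Bits Q) (Bits Q) ℂ} (hA : A ∈ localAlgebra S) :
    (matrix C)ᴴ * A * matrix C ∈ localAlgebra (lightCone C S) := by
  induction C using List.reverseRecOn generalizing S A with
  | nil => simpa [matrix, lightCone] using hA
  | append_singleton C g ih =>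
    have hassoc : (matrix (C ++ [g]))ᴴ * A * matrix (C ++ [g]) =
        (matrix C)ᴴ * (g.matrixᴴ * A * g.matrix) * matrix C := by
      simp only [matrix_append_singleton, Matrix.conjTranspose_mul, Matrix.mul_assoc]
    have hg := g.matrix_mem_localAlgebra
    rw [hassoc, lightCone_append_singleton]
    refine ih ?_
    split_ifs with hd
    · have hgg : g.matrixᴴ * g.matrix = 1 :=
        Matrix.mem_unitaryGroup_iff'.1 g.matrix_mem_unitaryGroup
      rwa [Matrix.mul_assoc, (commute_of_mem_localAlgebra hd hA hg).eq, ← Matrix.mul_assoc, hgg,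
        Matrix.one_mul]
    · have hg' := localAlgebra_mono (Finset.subset_union_right (s₁ := S)) hg
      exact mul_mem (mul_mem (localAlgebra_mono Finset.subset_union_right
        (conjTranspose_mem_localAlgebra hg)) (localAlgebra_mono Finset.subset_union_left hA)) hg'

end Circuit

lemma sum_pow_union_le {W : ℕ} (hW : 1 ≤ W) {S T : Finset Q} (hT : T.card ≤ W) {h : Q → ℕ} {l : ℕ}
    {r₀ : Q} (hS₀ : r₀ ∈ S) (hT₀ : r₀ ∈ T) (hl : l < h r₀) :
    ∑ r ∈ S ∪ T, W ^ (if r ∈ T then l else h r) ≤ ∑ r ∈ S, W ^ h r := by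
  have hT_sum : ∑ r ∈ T, W ^ (if r ∈ T then l else h r) ≤ ∑ r ∈ S ∩ T, W ^ h r := calc
    ∑ r ∈ T, W ^ (if r ∈ T then l else h r) = T.card * W ^ l := by
      rw [Finset.sum_congr rfl fun r hr => by rw [if_pos hr], Finset.sum_const, smul_eq_mul]
    _ ≤ W * W ^ l := Nat.mul_le_mul_right _ hT
    _ = W ^ (l + 1) := (pow_succ' W l).symm
    _ ≤ W ^ h r₀ := Nat.pow_le_pow_right hW hl
    _ ≤ ∑ r ∈ S ∩ T, W ^ h r :=
      Finset.single_le_sum (f := fun r => W ^ h r) (fun _ _ => Nat.zero_le _)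
        (Finset.mem_inter.2 ⟨hS₀, hT₀⟩)
  calc ∑ r ∈ S ∪ T, W ^ (if r ∈ T then l else h r)
      = ∑ r ∈ S \ T, W ^ h r + ∑ r ∈ T, W ^ (if r ∈ T then l else h r) := by
        rw [← Finset.sdiff_union_self_eq_union, Finset.sum_union Finset.sdiff_disjoint,
          Finset.sum_congr rfl fun r hr => by rw [if_neg (Finset.mem_sdiff.1 hr).2]]
    _ ≤ ∑ r ∈ S \ T, W ^ h r + ∑ r ∈ S ∩ T, W ^ h r := by gcongr
    _ = ∑ r ∈ S, W ^ h r := by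
        rw [← Finset.sum_sdiff (Finset.inter_subset_left (s₁ := S) (s₂ := T)),
          Finset.sdiff_inter_self_left]

namespace Circuit

/- The weight `∑ r ∈ S, W ^ h r`, where `h r` bounds the number of layers that still act on `r`,
does not increase when a gate is absorbed into the cone `S`. -/
lemma card_lightCone_le_sum {W : ℕ} (hW : 1 ≤ W) (L : List (Gate Q × ℕ))
    (hL : L.Pairwise fun a b => ¬ Disjoint a.1.support b.1.support → a.2 < b.2)
    (hcard : ∀ a ∈ L, a.1.support.card ≤ W) (S : Finset Q) (h : Q → ℕ)
    (hh : ∀ a ∈ L, ∀ r ∈ S, r ∈ a.1.support → a.2 < h r) :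
    (lightCone (L.map Prod.fst) S).card ≤ ∑ r ∈ S, W ^ h r := by
  induction L using List.reverseRecOn generalizing S h with
  | nil =>
    simpa [lightCone] using Finset.card_nsmul_le_sum S (fun r => W ^ h r) 1
      fun r _ => Nat.one_le_pow _ _ hW
  | append_singleton L a ih =>
    obtain ⟨g, l⟩ := a
    obtain ⟨hL, -, hg⟩ := List.pairwise_append.1 hL
    simp only [List.mem_append, List.mem_singleton, or_imp, forall_and, forall_eq] at hcard hh hg
    rw [List.map_append, List.map_singleton, lightCone_append_singleton]
    split_ifs with hd
    · exact ih hL hcard.1 S h hh.1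
    · obtain ⟨r₀, hS₀, hT₀⟩ := Finset.not_disjoint_iff.1 hd
      refine (ih hL hcard.1 _ (fun r => if r ∈ g.support then l else h r) ?_).trans
        (sum_pow_union_le hW hcard.2 hS₀ hT₀ (hh.2 r₀ hS₀ hT₀))
      intro a ha r hr hra
      by_cases hrg : r ∈ g.support
      · rw [if_pos hrg]
        exact hg a ha (Finset.not_disjoint_iff.2 ⟨r, hra, hrg⟩)
      · rw [if_neg hrg]
        exact hh.1 a ha r ((Finset.mem_union.1 hr).resolve_right hrg) hra

lemma card_lightCone_le {C : Circuit Q} {d W : ℕ} (hd : C.depth ≤ d) (hW : 1 ≤ W)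
    (hcard : ∀ g ∈ C, g.support.card ≤ W) (S : Finset Q) :
    (lightCone C S).card ≤ S.card * W ^ d := by
  obtain ⟨layer, hlayer⟩ := exists_isLayering hd
  let L : List (Gate Q × ℕ) := List.ofFn fun i => (C.get i, (layer i : ℕ))
  have hLC : L.map Prod.fst = C := by
    simp [L, List.map_ofFn, Function.comp_def]
  have hmem (a) (ha : a ∈ L) : a.1 ∈ C ∧ a.2 < d := by
    obtain ⟨i, rfl⟩ := (List.mem_ofFn' _ _).1 ha
    exact ⟨List.get_mem _ _, (layer i).2⟩
  calc (lightCone C S).card = (lightCone (L.map Prod.fst) S).card := by rw [hLC]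
    _ ≤ ∑ _r ∈ S, W ^ d :=
      card_lightCone_le_sum hW L (List.pairwise_ofFn.2 fun i j hij => hlayer i j hij)
        (fun a ha => hcard a.1 (hmem a ha).1) S _ fun a ha _ _ _ => (hmem a ha).2
    _ = S.card * W ^ d := by rw [Finset.sum_const, smul_eq_mul]

end Circuit

variable [Fintype Q]

lemma apply_flipBits_flipBits_of_mem_localAlgebra {S : Finset Q} {A : Matrix (Bits Q) (Bits Q) ℂ}
    (hA : A ∈ localAlgebra S) {i : Q} (hi : i ∉ S) (z : Bits Q) :
    A (flipBits {i} z) (flipBits {i} z) = A z z := by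
  have hcomm : A * basisMap (flipBits {i}) = basisMap (flipBits {i}) * A :=
    commute_of_mem_localAlgebra (Finset.disjoint_singleton_right.2 hi) hA
      (basisMap_flipBits_mem_localAlgebra {i})
  simpa [Matrix.mul_apply, basisMap, (flipBits_involutive {i}).injective.eq_iff]
    using congrFun₂ hcomm (flipBits {i} z) z

lemma colNorm_proj_mul_flipBits {S : Finset Q} {i o : Q} {b : Bool}
    {U : Matrix (Bits Q) (Bits Q) ℂ} (hU : Uᴴ * proj {o} b * U ∈ localAlgebra S) (hi : i ∉ S)
    (z : Bits Q) :
    colNorm (proj {o} b * U) (flipBits {i} z) = colNorm (proj {o} b * U) z := by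
  have hgram : (proj {o} b * U)ᴴ * (proj {o} b * U) = Uᴴ * proj {o} b * U := by
    rw [Matrix.conjTranspose_mul, conjTranspose_proj, Matrix.mul_assoc,
      ← Matrix.mul_assoc (proj _ _), proj_mul_self, ← Matrix.mul_assoc]
  refine (sq_eq_sq₀ (colNorm_nonneg _ _) (colNorm_nonneg _ _)).1 (Complex.ofReal_injective ?_)
  rw [ofReal_colNorm_sq, ofReal_colNorm_sq, hgram,
    apply_flipBits_flipBits_of_mem_localAlgebra hU hi]

end LightCone

section Parity

open scoped Matrix.Norms.Frobenius

variable {n p q : ℕ}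

lemma card_qubit : Fintype.card (Qubit n p q) = n + 1 + p + q := by
  rw [← Fintype.card_congr (Qubit.proxyTypeEquiv n p q)]
  simp
  omega

lemma card_filter_initialized_eq_false_mul_two_pow :
    (Finset.univ.filter fun z : Bits (Qubit n p q) => ∀ i, z (.initialized i) = false).card *
      2 ^ p = 2 ^ Fintype.card (Qubit n p q) := by
  have hinj : Function.Injective (Qubit.initialized : Fin p → Qubit n p q) :=
    fun i j h => by simpa using h
  simpa using card_filter_forall_mem_eq_mul_two_pow (Finset.univ.map ⟨_, hinj⟩) false

lemma exists_input_notMem {S : Finset (Qubit n p q)} (hS : S.card < n) :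
    ∃ i : Fin n, Qubit.input i ∉ S := by
  have hinj : Function.Injective (Qubit.input : Fin n → Qubit n p q) :=
    fun i j h => by simpa using h
  obtain ⟨r, hr, hrS⟩ := Finset.exists_mem_notMem_of_card_lt_card
    (s := S) (t := Finset.univ.map ⟨_, hinj⟩) (by simpa using hS)
  obtain ⟨i, -, rfl⟩ := Finset.mem_map.1 hr
  exact ⟨i, hrS⟩

lemma flipBits_input_apply_input (i : Fin n) (z : Bits (Qubit n p q)) :
    (fun j => flipBits {.input i} z (.input j)) =
      Function.update (fun j => z (.input j)) i (!z (.input i)) := by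
  ext j
  by_cases hj : j = i
  · simp [flipBits, hj]
  · simp [flipBits, hj]

lemma parity_update_not (x : Fin n → Bool) (i : Fin n) :
    parity n (Function.update x i (!x i)) = !parity n x := by
  have key (x : Fin n → Bool) (hx : x i = false) :
      parity n (Function.update x i true) = !parity n x := by
    have hinsert : (Finset.univ.filter fun j => Function.update x i true j = true) =
        insert i (Finset.univ.filter fun j => x j = true) := by
      ext j
      by_cases hj : j = i <;> simp [hj]
    rw [parity, parity, hinsert, Finset.card_insert_of_notMem (by simp [hx])]
    simp [Nat.odd_add_one, -Nat.not_odd_iff_even]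
  cases hx : x i with
  | false => exact key x hx
  | true =>
    have h := key (Function.update x i false) (by simp)
    rw [Function.update_idem, ← hx, Function.update_eq_self] at h
    rw [h, Bool.not_not, Bool.not_true]

namespace Circuit

lemma initialState_single (z : Bits (Qubit n p q)) (hz : ∀ i, z (.initialized i) = false) :
    initialState p (fun i => z (.input i)) (z .output)
      (EuclideanSpace.single (fun i => z (.uninitialized i)) 1) = Pi.single z 1 := by
  ext u
  have hu : u = z ↔ ((∀ i, u (.input i) = z (.input i)) ∧ u .output = z .output ∧
      ∀ i, u (.initialized i) = false) ∧
      (fun i => u (.uninitialized i)) = fun i => z (.uninitialized i) := by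
    refine ⟨by rintro rfl; simp [hz], fun ⟨⟨hin, hout, hinit⟩, hun⟩ => funext fun r => ?_⟩
    cases r with
    | input i => exact hin i
    | output => exact hout
    | initialized i => rw [hinit, hz]
    | uninitialized i => exact congrFun hun i
  simp only [initialState, Pi.single_apply, hu, PiLp.single_apply, ite_and]

variable {C : Circuit (Qubit n p q)} {f : (Fin n → Bool) → Bool}

lemma Computes.colNorm_proj_mul (hC : C.Computes f) {z : Bits (Qubit n p q)}
    (hz : ∀ i, z (.initialized i) = false) (b : Bool) :
    colNorm (proj {.output} b * matrix C) z =
      if b = xor (z .output) (f fun i => z (.input i)) then 1 else 0 := by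
  set v := xor (z .output) (f fun i => z (.input i))
  have hone : colNorm (proj {.output} v * matrix C) z ^ 2 = 1 := by
    rw [colNorm_proj_mul_sq, ← hC (fun i => z (.input i)) (z .output)
      (EuclideanSpace.single (fun i => z (.uninitialized i)) 1) (by simp), outputProb,
      initialState_single z hz, Matrix.mulVec_single_one]
    rfl
  split_ifs with hb
  · rw [hb]
    exact (pow_eq_one_iff_of_nonneg (colNorm_nonneg _ _) two_ne_zero).1 hone
  · have hsum := colNorm_proj_mul_sq_add .output v (matrix C) z
    rw [hone, colNorm_eq_one (matrix_mem_unitaryGroup C), one_pow, ← Bool.eq_not.2 hb] at hsum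
    exact pow_eq_zero_iff two_ne_zero |>.1 (by linarith)

variable {U : Matrix (Bits (Qubit n p q)) (Bits (Qubit n p q)) ℂ} {i : Fin n} {b : Bool}

lemma Computes.half_le_colNorm_sq_add (hC : C.Computes f)
    (hf : ∀ x, f (Function.update x i (!x i)) = !f x)
    (hU : ∀ z, colNorm (proj {.output} b * U) (flipBits {.input i} z) =
      colNorm (proj {.output} b * U) z)
    {z : Bits (Qubit n p q)} (hz : ∀ i, z (.initialized i) = false) :
    1 / 2 ≤ colNorm (matrix C - U) z ^ 2 + colNorm (matrix C - U) (flipBits {.input i} z) ^ 2 := by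
  set z' := flipBits {.input i} z with hz'
  have hz'_init (j) : z' (.initialized j) = false := by simpa [hz', flipBits] using hz j
  have hz'_out : z' .output = z .output := by simp [hz', flipBits]
  have hdiff : (colNorm (proj {.output} b * matrix C) z -
      colNorm (proj {.output} b * matrix C) z') ^ 2 = 1 := by
    rw [hC.colNorm_proj_mul hz, hC.colNorm_proj_mul hz'_init, hz'_out,
      flipBits_input_apply_input, hf, Bool.xor_not]
    cases b <;> cases xor (z .output) (f fun i => z (.input i)) <;> simp
  have hle := sq_colNorm_proj_mul_sub_le .output b (matrix C) U z
  have hle' := sq_colNorm_proj_mul_sub_le .output b (matrix C) U z'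
  rw [hU] at hle'
  nlinarith [sq_nonneg (colNorm (proj {.output} b * matrix C) z +
    colNorm (proj {.output} b * matrix C) z' - 2 * colNorm (proj {.output} b * U) z)]

lemma Computes.le_frobenius_norm_sub_sq (hC : C.Computes f)
    (hf : ∀ x, f (Function.update x i (!x i)) = !f x)
    (hU : ∀ z, colNorm (proj {.output} b * U) (flipBits {.input i} z) =
      colNorm (proj {.output} b * U) z) :
    2 ^ Fintype.card (Qubit n p q) / 2 ^ p / 4 ≤ ‖matrix C - U‖ ^ 2 := by
  set G := Finset.univ.filter fun z : Bits (Qubit n p q) => ∀ i, z (.initialized i) = false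
  let e (z : Bits (Qubit n p q)) : ℝ := colNorm (matrix C - U) z ^ 2
  have hcard : (G.card : ℝ) = 2 ^ Fintype.card (Qubit n p q) / 2 ^ p :=
    eq_div_of_mul_eq (by positivity)
      (by exact_mod_cast card_filter_initialized_eq_false_mul_two_pow)
  let σ : Equiv.Perm (Bits (Qubit n p q)) := (flipBits_involutive {.input i}).toPerm
  have hG (z) : z ∈ G ↔ σ z ∈ G := by
    simp [G, σ, flipBits]
  have hflip : ∑ z ∈ G, e (σ z) = ∑ z ∈ G, e z := Finset.sum_equiv σ hG fun _ _ => rfl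
  have hsum : (G.card : ℝ) * (1 / 2) ≤ 2 * ∑ z ∈ G, e z := calc
    (G.card : ℝ) * (1 / 2) = ∑ z ∈ G, (1 / 2 : ℝ) := by rw [Finset.sum_const, nsmul_eq_mul]
    _ ≤ ∑ z ∈ G, (e z + e (σ z)) := Finset.sum_le_sum fun z hz =>
      hC.half_le_colNorm_sq_add hf hU (Finset.mem_filter.1 hz).2
    _ = 2 * ∑ z ∈ G, e z := by rw [Finset.sum_add_distrib, hflip, two_mul]
  have hnorm : ∑ z ∈ G, e z ≤ ‖matrix C - U‖ ^ 2 := by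
    rw [frobenius_norm_sq_eq_sum_colNorm_sq]
    exact Finset.sum_le_univ_sum_of_nonneg fun z => sq_nonneg _
  rw [← hcard]
  linarith

end Circuit

section SmallGates

variable {Q : Type}

/-- All gates but the Toffoli gates with at least `K` controls. -/
def Gate.isSmall (K : ℕ) : Gate Q → Bool
  | toffoli S _ _ _ => decide (S.card < K)
  | _ => true

variable [DecidableEq Q]

lemma Gate.card_support_le_of_isSmall {K w : ℕ} {g : Gate Q} (hg : g.isSmall K = true)
    (hw : g.FanoutAtMost w) : g.support.card ≤ 2 + w + K := by
  cases g with
  | hadamard a => exact (Finset.card_singleton a).trans_le (by omega)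
  | phase a c t ht => exact (Finset.card_singleton a).trans_le (by omega)
  | cnot c t h => exact Finset.card_le_two.trans (by omega)
  | fanout c T hne h =>
    rw [FanoutAtMost] at hw
    exact hw.trans (by omega)
  | toffoli S t hne h =>
    have hS : S.card < K := of_decide_eq_true hg
    exact (Finset.card_insert_le t S).trans (by omega)

variable [Fintype Q]

lemma Gate.frobenius_norm_sub_one_sq_le_of_isSmall_eq_false {K : ℕ} {g : Gate Q}
    (hg : g.isSmall K = false) : ‖g.matrix - 1‖ ^ 2 ≤ 2 * (2 ^ Fintype.card Q / 2 ^ K) := by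
  cases g with
  | toffoli S t hne h =>
    have hS : K ≤ S.card := not_lt.1 (of_decide_eq_false hg)
    rw [matrix_toffoli]
    refine (frobenius_norm_basisMap_controlledFlip_sub_one_sq_le S {t}).trans ?_
    gcongr
    norm_num
  | _ => simp [Gate.isSmall] at hg

lemma Circuit.frobenius_norm_sub_filter_isSmall_sq_le {C : Circuit Q} {d : ℕ} (hd : C.depth ≤ d)
    (K : ℕ) :
    ‖C.matrix - Circuit.matrix (C.filter (Gate.isSmall K))‖ ^ 2 ≤
      (d * Fintype.card Q) ^ 2 * (2 * (2 ^ Fintype.card Q / 2 ^ K)) := by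
  set η : ℝ := 2 * (2 ^ Fintype.card Q / 2 ^ K)
  have hlen : (C.length : ℝ) ≤ d * Fintype.card Q := by exact_mod_cast length_le_mul_card hd
  calc ‖matrix C - matrix (C.filter (Gate.isSmall K))‖ ^ 2
      ≤ (C.length * √η) ^ 2 := by
        gcongr
        exact frobenius_norm_sub_filter_le C _ (Real.sqrt_nonneg _) fun g _ hg =>
          Real.le_sqrt_of_sq_le (Gate.frobenius_norm_sub_one_sq_le_of_isSmall_eq_false hg)
    _ = C.length ^ 2 * η := by rw [mul_pow, Real.sq_sqrt (by positivity)]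
    _ ≤ (d * Fintype.card Q) ^ 2 * η := by gcongr

end SmallGates

namespace Circuit.Computes

variable {C : Circuit (Qubit n p q)} {d w : ℕ}

lemma two_pow_le (hC : C.Computes (parity n)) (hd : C.depth ≤ d)
    (hw : ∀ g ∈ C, g.FanoutAtMost w) {K : ℕ} (hn : (2 + w + K) ^ d < n) :
    2 ^ K ≤ 8 * (d * (n + 1 + p + q)) ^ 2 * 2 ^ p := by
  set C' := C.filter (Gate.isSmall K)
  have hcone : (lightCone C' {.output}).card < n := by
    refine (card_lightCone_le ((depth_le_of_sublist List.filter_sublist).trans hd)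
      (W := 2 + w + K) (by omega) (fun g hg => ?_) {.output}).trans_lt (by simpa using hn)
    obtain ⟨hgC, hg⟩ := List.mem_filter.1 hg
    exact Gate.card_support_le_of_isSmall hg (hw g hgC)
  obtain ⟨i, hi⟩ := exists_input_notMem hcone
  have hlower := hC.le_frobenius_norm_sub_sq (fun x => parity_update_not x i)
    (colNorm_proj_mul_flipBits (b := true)
      (conj_mem_localAlgebra_lightCone C' (proj_mem_localAlgebra _ _)) hi)
  have hupper := hlower.trans (frobenius_norm_sub_filter_isSmall_sq_le hd K)
  set N := Fintype.card (Qubit n p q) with hN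
  have hbound : (2 : ℝ) ^ N * 2 ^ K ≤ 2 ^ N * (8 * (d * N) ^ 2 * 2 ^ p) := by
    rw [div_div, div_le_iff₀ (by positivity), ← mul_div_assoc, ← mul_div_assoc, div_mul_eq_mul_div,
      le_div_iff₀ (by positivity)] at hupper
    linarith
  rw [card_qubit] at hN
  rw [mul_le_mul_iff_right₀ (by positivity), hN] at hbound
  exact_mod_cast hbound

lemma le_pow (hC : C.Computes (parity n)) (hd : C.depth ≤ d) (hw : ∀ g ∈ C, g.FanoutAtMost w) :
    n ≤ (2 + w + (3 + 2 * (d + n.size + p + q.size) + p)) ^ d := by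
  by_contra! hn
  refine (hC.two_pow_le hd hw hn).not_gt ?_
  have hqubits : n + 1 + p + q ≤ 2 ^ n.size * 2 ^ p * 2 ^ q.size := calc
    n + 1 + p + q ≤ (n + 1) * (p + 1) * (q + 1) := by nlinarith [Nat.zero_le (n * p * q)]
    _ ≤ 2 ^ n.size * 2 ^ p * 2 ^ q.size := by
      gcongr
      exacts [n.lt_size_self, p.lt_two_pow_self, q.lt_size_self]
  have hgates : d * (n + 1 + p + q) < 2 ^ (d + n.size + p + q.size) := calc
    d * (n + 1 + p + q) < 2 ^ d * (n + 1 + p + q) := by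
      gcongr
      exact d.lt_two_pow_self
    _ ≤ 2 ^ d * (2 ^ n.size * 2 ^ p * 2 ^ q.size) := by gcongr
    _ = 2 ^ (d + n.size + p + q.size) := by ring
  calc 8 * (d * (n + 1 + p + q)) ^ 2 * 2 ^ p
      < 8 * (2 ^ (d + n.size + p + q.size)) ^ 2 * 2 ^ p := by gcongr
    _ = 2 ^ (3 + 2 * (d + n.size + p + q.size) + p) := by ring

end Circuit.Computes

end Parity

section Asymptotics

open Filter Asymptotics

lemma tendsto_log_natCast_atTop : Tendsto (fun n : ℕ => Real.log n) atTop atTop :=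
  Real.tendsto_log_atTop.comp tendsto_natCast_atTop_atTop

lemma tendsto_log_log_natCast_atTop : Tendsto (fun n : ℕ => Real.log (Real.log n)) atTop atTop :=
  Real.tendsto_log_atTop.comp tendsto_log_natCast_atTop

/-- Polylogarithmic growth, `f n = (log n) ^ O(1)`. -/
def IsPolylog (f : ℕ → ℕ) : Prop :=
  ∃ k : ℕ, (fun n => (f n : ℝ)) =O[atTop] fun n : ℕ => Real.log n ^ k

lemma isBigO_log_pow_log_pow {k l : ℕ} (h : k ≤ l) :
    (fun n : ℕ => Real.log n ^ k) =O[atTop] fun n : ℕ => Real.log n ^ l :=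
  IsBigO.pow_of_le_right (tendsto_log_natCast_atTop.eventually_ge_atTop 1) h

namespace IsPolylog

variable {f g : ℕ → ℕ}

lemma const (c : ℕ) : IsPolylog fun _ => c :=
  ⟨0, by simpa only [pow_zero] using isBigO_const_const (c : ℝ) one_ne_zero atTop⟩

lemma add (hf : IsPolylog f) (hg : IsPolylog g) : IsPolylog fun n => f n + g n := by
  obtain ⟨k, hf⟩ := hf
  obtain ⟨l, hg⟩ := hg
  refine ⟨max k l, ?_⟩
  simpa only [Nat.cast_add] using (hf.trans (isBigO_log_pow_log_pow (le_max_left k l))).add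
    (hg.trans (isBigO_log_pow_log_pow (le_max_right k l)))

lemma const_mul (hf : IsPolylog f) (c : ℕ) : IsPolylog fun n => c * f n := by
  obtain ⟨k, hf⟩ := hf
  exact ⟨k, by simpa only [Nat.cast_mul] using hf.const_mul_left (c : ℝ)⟩

lemma log_isBigO (hf : IsPolylog f) :
    (fun n => Real.log (f n)) =O[atTop] fun n : ℕ => Real.log (Real.log n) := by
  obtain ⟨k, hf⟩ := hf
  obtain ⟨A, hA, hf⟩ := hf.exists_pos
  refine IsBigO.of_bound (|Real.log A| + k) ?_
  filter_upwards [hf.bound, tendsto_log_natCast_atTop.eventually_gt_atTop 0,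
    tendsto_log_log_natCast_atTop.eventually_ge_atTop 1] with n hn hlog hloglog
  rw [Real.norm_natCast, Real.norm_of_nonneg (by positivity)] at hn
  rw [Real.norm_of_nonneg (Real.log_natCast_nonneg _), Real.norm_of_nonneg (by linarith)]
  rcases (f n).eq_zero_or_pos with hfn | hfn
  · rw [hfn, Nat.cast_zero, Real.log_zero]
    positivity
  · calc Real.log (f n) ≤ Real.log (A * Real.log n ^ k) :=
          Real.log_le_log (by exact_mod_cast hfn) hn
      _ = Real.log A + k * Real.log (Real.log n) := by
          rw [Real.log_mul hA.ne' (by positivity), Real.log_pow]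
      _ ≤ |Real.log A| * Real.log (Real.log n) + k * Real.log (Real.log n) := by
          gcongr
          exact (le_abs_self _).trans (le_mul_of_one_le_right (abs_nonneg _) hloglog)
      _ = (|Real.log A| + k) * Real.log (Real.log n) := by ring

end IsPolylog

lemma isPolylog_of_isLittleO_log_div_log_log {d : ℕ → ℕ}
    (hd : (fun n => (d n : ℝ)) =o[atTop] fun n : ℕ => Real.log n / Real.log (Real.log n)) :
    IsPolylog d := by
  refine ⟨1, hd.isBigO.trans (IsBigO.of_bound 1 ?_)⟩
  filter_upwards [tendsto_log_log_natCast_atTop.eventually_ge_atTop 1] with n hn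
  rw [pow_one, one_mul, norm_div]
  exact div_le_self (norm_nonneg _) (hn.trans (Real.le_norm_self _))

lemma size_le_two_mul_log_add_one (m : ℕ) : (m.size : ℝ) ≤ 2 * Real.log m + 1 := by
  rcases hs : m.size with _ | s
  · rw [Nat.cast_zero]
    linarith [Real.log_natCast_nonneg m]
  · have hpow : 2 ^ s ≤ m := Nat.lt_size.1 (hs ▸ s.lt_succ_self)
    have hlog : s * Real.log 2 ≤ Real.log m := by
      rw [← Real.log_pow]
      exact Real.log_le_log (by positivity) (by exact_mod_cast hpow)
    rw [Nat.cast_succ]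
    nlinarith [Real.log_two_gt_d9, (Nat.cast_nonneg s : (0 : ℝ) ≤ s)]

lemma isPolylog_size_of_isBigO_exp {q : ℕ → ℕ} {k : ℕ}
    (hq : (fun n => (q n : ℝ)) =O[atTop] fun n : ℕ => Real.exp (Real.log n ^ k)) :
    IsPolylog fun n => (q n).size := by
  obtain ⟨A, hA, hq⟩ := hq.exists_pos
  refine ⟨k, IsBigO.of_bound (2 * |Real.log A| + 3) ?_⟩
  filter_upwards [hq.bound, tendsto_log_natCast_atTop.eventually_ge_atTop 1] with n hn hlog
  have hpow : 1 ≤ Real.log n ^ k := one_le_pow₀ hlog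
  rw [Real.norm_natCast, Real.norm_of_nonneg (Real.exp_nonneg _)] at hn
  rw [Real.norm_natCast, Real.norm_of_nonneg (by positivity)]
  have hlogq : Real.log (q n) ≤ |Real.log A| + Real.log n ^ k := by
    rcases (q n).eq_zero_or_pos with hqn | hqn
    · rw [hqn, Nat.cast_zero, Real.log_zero]
      positivity
    · calc Real.log (q n) ≤ Real.log (A * Real.exp (Real.log n ^ k)) :=
            Real.log_le_log (by exact_mod_cast hqn) hn
        _ = Real.log A + Real.log n ^ k := by
            rw [Real.log_mul hA.ne' (Real.exp_ne_zero _), Real.log_exp]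
        _ ≤ |Real.log A| + Real.log n ^ k := by
            gcongr
            exact le_abs_self _
  calc ((q n).size : ℝ) ≤ 2 * Real.log (q n) + 1 := size_le_two_mul_log_add_one _
    _ ≤ 2 * (|Real.log A| + Real.log n ^ k) + 1 := by gcongr
    _ ≤ (2 * |Real.log A| + 3) * Real.log n ^ k := by nlinarith [abs_nonneg (Real.log A)]

lemma isPolylog_size : IsPolylog Nat.size := by
  refine isPolylog_size_of_isBigO_exp (q := id) (k := 1) (EventuallyEq.isBigO ?_)
  filter_upwards [eventually_gt_atTop 0] with n hn
  rw [pow_one, Real.exp_log (by exact_mod_cast hn), id]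

lemma eventually_pow_lt {d W : ℕ → ℕ}
    (hd : (fun n => (d n : ℝ)) =o[atTop] fun n : ℕ => Real.log n / Real.log (Real.log n))
    (hW : IsPolylog W) : ∀ᶠ n in atTop, W n ^ d n < n := by
  have hmul : (fun n => d n * Real.log (W n)) =o[atTop] fun n : ℕ => Real.log n := by
    refine (hd.mul_isBigO hW.log_isBigO).congr' .rfl ?_
    filter_upwards [tendsto_log_log_natCast_atTop.eventually_ne_atTop 0] with n hn
    exact div_mul_cancel₀ _ hn
  filter_upwards [hmul.bound one_half_pos, tendsto_log_natCast_atTop.eventually_gt_atTop 0,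
    eventually_gt_atTop 0] with n hn hlog hn0
  rw [Real.norm_of_nonneg hlog.le] at hn
  have hpow : ((W n ^ d n : ℕ) : ℝ) < n := calc
    ((W n ^ d n : ℕ) : ℝ) = (W n : ℝ) ^ d n := Nat.cast_pow _ _
    _ ≤ Real.exp (Real.log (W n)) ^ d n := by
      gcongr
      exact Real.le_exp_log _
    _ = Real.exp (d n * Real.log (W n)) := (Real.exp_nat_mul _ _).symm
    _ < Real.exp (Real.log n) := Real.exp_lt_exp.2 (by linarith [(Real.le_norm_self _).trans hn])
    _ = n := Real.exp_log (by exact_mod_cast hn0)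
  exact_mod_cast hpow

lemma isLittleO_log_rpow {δ : ℝ} (hδ : δ < 1) :
    (fun n : ℕ => Real.log n ^ δ) =o[atTop] fun n : ℕ => Real.log n / Real.log (Real.log n) := by
  suffices h : (fun x : ℝ => x ^ δ) =o[atTop] fun x => x / Real.log x from
    h.comp_tendsto tendsto_log_natCast_atTop
  have hlog := (isBigO_refl (fun x : ℝ => x ^ δ / Real.log x) atTop).mul_isLittleO
    (isLittleO_log_rpow_atTop (sub_pos.2 hδ))
  refine hlog.congr' ?_ ?_
  · filter_upwards [Real.tendsto_log_atTop.eventually_ne_atTop 0] with x hx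
    exact div_mul_cancel₀ _ hx
  · filter_upwards [eventually_gt_atTop 0] with x hx
    rw [div_mul_eq_mul_div, ← Real.rpow_add hx, add_sub_cancel, Real.rpow_one]

lemma isBigO_pow_exp_log_sq (k : ℕ) :
    (fun n : ℕ => (n : ℝ) ^ k) =O[atTop] fun n : ℕ => Real.exp (Real.log n ^ 2) := by
  refine IsBigO.of_bound 1 ?_
  filter_upwards [eventually_gt_atTop 0, tendsto_log_natCast_atTop.eventually_ge_atTop (k : ℝ)]
    with n hn hk
  have hn' : (0 : ℝ) < n := by exact_mod_cast hn
  rw [one_mul, Real.norm_of_nonneg (by positivity), Real.norm_of_nonneg (Real.exp_nonneg _)]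
  calc (n : ℝ) ^ k = Real.exp (k * Real.log n) := by rw [Real.exp_nat_mul, Real.exp_log hn']
    _ ≤ Real.exp (Real.log n ^ 2) := by
      rw [sq]
      gcongr

end Asymptotics

end QCircuit

open QCircuit in
theorem theorem3_general (d p q w : ℕ → ℕ)
    (hd : (fun n => (d n : ℝ)) =o[Filter.atTop] fun n : ℕ => Real.log n / Real.log (Real.log n))
    (hp : IsPolylog p)
    (hq : ∃ k : ℕ, (fun n => (q n : ℝ)) =O[Filter.atTop] fun n : ℕ => Real.exp (Real.log n ^ k))
    (hw : IsPolylog w) :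
    ∀ᶠ n : ℕ in Filter.atTop,
      ∀ C : Circuit (Qubit n (p n) (q n)),
        C.depth ≤ d n → (∀ g ∈ C, g.FanoutAtMost (w n)) → ¬ C.Computes (parity n) := by
  obtain ⟨k, hq⟩ := hq
  have hqubits : IsPolylog fun n => d n + n.size + p n + (q n).size :=
    (((isPolylog_of_isLittleO_log_div_log_log hd).add isPolylog_size).add hp).add
      (isPolylog_size_of_isBigO_exp hq)
  have hW : IsPolylog fun n =>
      2 + w n + (3 + 2 * (d n + n.size + p n + (q n).size) + p n) :=
    ((IsPolylog.const 2).add hw).add (((IsPolylog.const 3).add (hqubits.const_mul 2)).add hp)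
  filter_upwards [eventually_pow_lt hd hW] with n hn C hdepth hfanout hC
  exact (hC.le_pow hdepth hfanout).not_gt hn

theorem theorem3 (δ : ℝ) (hδ0 : 0 ≤ δ) (hδ1 : δ < 1) (d p q w : ℕ → ℕ)
    (hd : (fun n => (d n : ℝ)) =O[Filter.atTop] fun n : ℕ => Real.log n ^ δ)
    (hp : (fun n => (p n : ℝ)) =O[Filter.atTop] fun n : ℕ => Real.log n)
    (hq : ∃ k : ℕ, (fun n => (q n : ℝ)) =O[Filter.atTop] fun n : ℕ => (n : ℝ) ^ k)
    (hw : ∃ k : ℕ, (fun n => (w n : ℝ)) =O[Filter.atTop] fun n : ℕ => Real.log n ^ k) :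
    ∀ᶠ n : ℕ in Filter.atTop,
      ∀ C : QCircuit.Circuit (QCircuit.Qubit n (p n) (q n)),
        C.depth ≤ d n → (∀ g ∈ C, g.FanoutAtMost (w n)) →
          ¬ C.Computes (QCircuit.parity n) :=
  theorem3_general d p q w (hd.trans_isLittleO (QCircuit.isLittleO_log_rpow hδ1))
    ⟨1, by simpa only [pow_one] using hp⟩
    (hq.imp' (fun _ => 2) fun k h => h.trans (QCircuit.isBigO_pow_exp_log_sq k)) hw
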